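/- Let $G$ be a finite simple connected graph with vertex set $V$. For $S\subseteq V$ let $c(S)$ be the number of connected components of $G\setminus S$. Call $S$ a cut set if $S=\varnothing$ or $c(S\setminus\{i\})<c(S)$ for every $i\in S$; a minimal vertex separator if $S$ is a cut set and $c(S)=2$; and a minimal vertex isolator if moreover one of the two connected components of $G\setminus S$ is a single vertex. For a vertex $v$ let $N(v)$ be the set of its neighbors and $N[v]=N(v)\cup\{v\}$. Suppose that $G$ has three distinct, pairwise nonadjacent vertices $v_1,v_2,v_3$ such that, for $i=1,2,3$, the set $N(v_i)$ is a minimal vertex isolator of $G$ and $G\setminus N(v_i)=\{v_i\}\sqcup(G\setminus N[v_i])$ (disjoint union of graphs). Then for every prime $p$ and every field $\Bbbk$ of characteristic $p$ the ring $$R_G=\Bbbk[x_v,y_v : v\in V]/J_G,\qquad J_G=\bigl(x_iy_j-x_jy_i : \{i,j\}\in E(G)\bigr),$$ is not F-pure. Here a ring $R$ of characteristic $p$ is F-pure if for every $R$-module $M$ the map $M\to M\otimes_R F_*R$ induced by the Frobenius $F\colon R\to F_*R$, $r\mapsto r^p$, is injective, where $F_*R$ is $R$ as an abelian group with the $R$-module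 structure $r\cdot s=r^ps$. -/

import Mathlib

universe u v

open scoped TensorProduct

/-! ### F-purity -/

section FPure

/-- The `R`-module `F_* R`: the ring `R`, on which `r : R` acts by multiplication by `r ^ p`. -/
def FrobPush (R : Type u) (_p : ℕ) : Type u := R

instance (R : Type u) [CommRing R] (p : ℕ) : AddCommGroup (FrobPush R p) :=
  inferInstanceAs (AddCommGroup R)

instance (R : Type u) [CommRing R] (p : ℕ) [Fact p.Prime] [CharP R p] :
    Module R (FrobPush R p) :=
  letI : Module R R := Semiring.toModule
  Module.compHom R (frobenius R p)

/-- The Frobenius `F : R → F_* R`, `r ↦ r ^ p`, as an `R`-linear map. -/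
def frobPushMap (R : Type u) [CommRing R] (p : ℕ) [Fact p.Prime] [CharP R p] :
    R →ₗ[R] FrobPush R p where
  toFun r := (frobenius R p r : R)
  map_add' r s := (frobenius R p).map_add r s
  map_smul' r s := (frobenius R p).map_mul r s

/-- A ring `R` of prime characteristic `p` is F-pure if for every `R`-module `M` the map
`M ≅ M ⊗ R → M ⊗ F_* R` induced by the Frobenius is injective. -/
def IsFPure (R : Type u) [CommRing R] (p : ℕ) [Fact p.Prime] [CharP R p] : Prop :=
  ∀ (M : Type u) [AddCommGroup M] [Module R M],
    Function.Injective
      ((frobPushMap R p).lTensor M ∘ₗ (TensorProduct.rid R M).symm.toLinearMap :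
        M →ₗ[R] M ⊗[R] FrobPush R p)

end FPure

/-! ### Binomial edge ideals -/

section BinomialEdge

variable {V : Type v}

/-- The binomial `f_{i,j} = x_i y_j - x_j y_i` in the polynomial ring with variables
`x_i = X (Sum.inl i)` and `y_i = X (Sum.inr i)`, for `i : V`. -/
noncomputable def edgeBinomial (K : Type u) [Field K] (i j : V) : MvPolynomial (V ⊕ V) K :=
  MvPolynomial.X (Sum.inl i) * MvPolynomial.X (Sum.inr j)
    - MvPolynomial.X (Sum.inl j) * MvPolynomial.X (Sum.inr i)

/-- The binomial edge ideal `J_G`. -/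
noncomputable def binomialEdgeIdeal (K : Type u) [Field K] (G : SimpleGraph V) :
    Ideal (MvPolynomial (V ⊕ V) K) :=
  Ideal.span {f | ∃ i j : V, G.Adj i j ∧ f = edgeBinomial K i j}

/-- The ring `R_G`, the quotient of the polynomial ring by `J_G`. -/
abbrev BinomialEdgeRing (K : Type u) [Field K] (G : SimpleGraph V) : Type (max u v) :=
  MvPolynomial (V ⊕ V) K ⧸ binomialEdgeIdeal K G

theorem binomialEdgeIdeal_ne_top (K : Type u) [Field K] (G : SimpleGraph V) :
    binomialEdgeIdeal K G ≠ ⊤ := by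
  have h : binomialEdgeIdeal K G ≤
      RingHom.ker (MvPolynomial.constantCoeff : MvPolynomial (V ⊕ V) K →+* K) := by
    refine Ideal.span_le.2 ?_
    rintro f ⟨i, j, -, rfl⟩
    simp [edgeBinomial, RingHom.mem_ker]
  intro ht
  exact RingHom.ker_ne_top _ (top_le_iff.1 (ht ▸ h))

instance (K : Type u) [Field K] (G : SimpleGraph V) : Nontrivial (BinomialEdgeRing K G) :=
  Ideal.Quotient.nontrivial_iff.2 (binomialEdgeIdeal_ne_top K G)

instance (K : Type u) [Field K] (p : ℕ) [CharP K p] (G : SimpleGraph V) :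
    CharP (BinomialEdgeRing K G) p :=
  charP_of_injective_algebraMap (algebraMap K (BinomialEdgeRing K G)).injective p

end BinomialEdge

/-! ### Vertex separators and isolators -/

section Graph

variable {V : Type v}

/-- The number `c(S)` of connected components of `G ∖ S`. -/
noncomputable def numComponents (G : SimpleGraph V) (S : Set V) : ℕ :=
  Nat.card (G.induce Sᶜ).ConnectedComponent

/-- `S` is a cut set of `G`: either `S` is empty or putting back any vertex of `S`
decreases the number of connected components of `G ∖ S`. -/
def IsCutSet (G : SimpleGraph V) (S : Set V) : Prop :=
  S = ∅ ∨ ∀ i ∈ S, numComponents G (S \ {i}) < numComponents G S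

/-- A minimal vertex separator: a cut set `S` such that `G ∖ S` has exactly two components. -/
def IsMinimalVertexSeparator (G : SimpleGraph V) (S : Set V) : Prop :=
  IsCutSet G S ∧ numComponents G S = 2

/-- A minimal vertex isolator: a minimal vertex separator `S` such that one of the components of
`G ∖ S` is a single vertex. -/
def IsMinimalVertexIsolator (G : SimpleGraph V) (S : Set V) : Prop :=
  IsMinimalVertexSeparator G S ∧
    ∃ (C : (G.induce Sᶜ).ConnectedComponent) (w : (Sᶜ : Set V)), C.supp = {w}

/-- The subgraph `G ∖ S` of `G`. -/
def deleteSet (G : SimpleGraph V) (S : Set V) : G.Subgraph :=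
  (⊤ : G.Subgraph).deleteVerts S

/-- The closed neighborhood `N[v]`. -/
def closedNbhd (G : SimpleGraph V) (v : V) : Set V := insert v (G.neighborSet v)

end Graph

/-! Write `f_uv` for the edge binomials and let `a, b, c` be the three vertices. Since `a` is
isolated off `N(a)` and there are only two components, `b` and `c` are joined off `N(a)`; likewise
cyclically. A walk joining them gives `g_a` with `g_a * f_bc ∈ J_G`, so `D = f_bc * f_ca * f_ab` is
killed modulo `J_G` by `g_a`, `g_b`, `g_c`.

In characteristic `p`, `D ^ (p - 1)` lies in the ideal of `p`-th powers of the six variables at `a,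
b, c` (`minors_pow_mem`). Hence the system `∑ x_i t_i = D`, `g_k t_i = 0` is solvable after
Frobenius, and F-purity would solve it in `R_G` itself (`IsFPure.exists_solution`).

No such solution exists. Being killed by `g_a` forces the restriction of a lift of `t_i` to `{a, b,
c}` to be divisible by `f_bc`, as a degeneration at `a` shows. So all three minors, hence `D`,
divide it. The triple is independent, so restriction kills `J_G`; cancelling `D` puts `1` in the
ideal of the variables. -/

/-! ### Solving linear systems by purity -/

section Purity

variable {R : Type u} [CommRing R] {p : ℕ} [Fact p.Prime] [CharP R p]

/-- The identity map of `R`, as an additive map to `F_* R`. -/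
def FrobPush.of (R : Type u) [CommRing R] (p : ℕ) : R →+ FrobPush R p := AddMonoidHom.id R

theorem FrobPush.smul_of (r s : R) : r • FrobPush.of R p s = FrobPush.of R p (r ^ p * s) := rfl

/-- In an F-pure ring, a linear system is solvable as soon as its Frobenius power is. -/
theorem IsFPure.exists_solution (hR : IsFPure R p) {ι κ : Type} [Fintype ι] [Fintype κ]
    (a : ι → R) (g : κ → R) (c : R) (z : ι → R)
    (hc : ∑ i, a i ^ p * z i = c ^ p) (hz : ∀ i j, g j ^ p * z i = 0) :
    ∃ t : ι → R, ∑ i, a i * t i = c ∧ ∀ i j, g j * t i = 0 := by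
  classical
  -- Purity is tested on the module with generators `u`, `e i j` and relations `a i • u + ∑ j, g j •
  -- e i j = 0`: there `c • u = 0` exactly when the system is solvable.
  let e : ι → κ → (R × (ι → κ → R)) := fun i j => (0, Pi.single i (Pi.single j 1))
  let rel : ι → (R × (ι → κ → R)) := fun i => a i • (1, 0) + ∑ j, g j • e i j
  let N : Submodule R (R × (ι → κ → R)) := Submodule.span R (Set.range rel)
  let q := N.mkQ
  have hrel : ∀ i, a i • q (1, 0) = - ∑ j, g j • q (e i j) := fun i => by
    have h : q (rel i) = 0 := by
      rw [Submodule.mkQ_apply, Submodule.Quotient.mk_eq_zero]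
      exact Submodule.subset_span ⟨i, rfl⟩
    simp only [rel, map_add, map_smul, map_sum] at h
    exact eq_neg_of_add_eq_zero_left h
  have htmul : ∀ i, q (1, 0) ⊗ₜ[R] FrobPush.of R p (a i ^ p * z i) = 0 := fun i => by
    rw [← FrobPush.smul_of, ← TensorProduct.smul_tmul, hrel, TensorProduct.neg_tmul,
      TensorProduct.sum_tmul, neg_eq_zero]
    refine Finset.sum_eq_zero fun j _ => ?_
    rw [TensorProduct.smul_tmul, FrobPush.smul_of, hz i j, map_zero, TensorProduct.tmul_zero]
  have hzero : c • q (1, 0) = 0 := by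
    refine hR _ ?_
    have hone : frobPushMap R p 1 = FrobPush.of R p 1 :=
      congrArg (FrobPush.of R p) (one_pow p)
    rw [map_zero, LinearMap.comp_apply, LinearEquiv.coe_coe, TensorProduct.rid_symm_apply,
      LinearMap.lTensor_tmul, hone, TensorProduct.smul_tmul, FrobPush.smul_of, mul_one, ← hc,
      map_sum, TensorProduct.tmul_sum]
    exact Finset.sum_eq_zero fun i _ => htmul i
  rw [← map_smul, Submodule.mkQ_apply, Submodule.Quotient.mk_eq_zero,
    Submodule.mem_span_range_iff_exists_fun] at hzero
  obtain ⟨t, ht⟩ := hzero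
  refine ⟨t, ?_, fun i j => ?_⟩
  · have := congrArg Prod.fst ht
    simpa [rel, e, Prod.fst_sum, mul_comm] using this
  · have := congrFun (congrFun (congrArg Prod.snd ht) i) j
    simpa [rel, e, Prod.snd_sum, Finset.sum_apply, Pi.single_apply, mul_comm, Finset.sum_ite_eq,
      apply_ite, ite_apply] using this

end Purity

/-! ### The power of a product of three minors -/

section Minors

/-- Divide `a ^ p - b ^ p = (a - b) ^ p` by `a - b`. When `a = b`, the right side is `p` equal terms
and vanishes. -/
theorem sub_pow_prime_sub_one {S : Type*} [CommRing S] [IsDomain S] (p : ℕ) [Fact p.Prime]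
    [CharP S p] (a b : S) :
    (a - b) ^ (p - 1) = ∑ i ∈ Finset.range p, a ^ i * b ^ (p - 1 - i) := by
  by_cases h : a - b = 0
  · have hp : p - 1 ≠ 0 := Nat.sub_ne_zero_of_lt (Fact.out : p.Prime).one_lt
    rw [sub_eq_zero.1 h, sub_self, zero_pow hp, geom_sum₂_self, CharP.cast_eq_zero, zero_mul]
  · refine mul_right_cancel₀ h ?_
    rw [(Commute.all a b).geom_sum₂_mul, ← sub_pow_char, ← pow_succ,
      Nat.sub_add_cancel (Fact.out : p.Prime).one_le]

/-- Modulo the `p`-th powers, only the terms with equal exponents `i = j = k` survive in the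
expansion. Each is the product of the six variables to the power `p - 1`, and there are `p` of them.
-/
theorem minors_pow_mem {S : Type*} [CommRing S] [IsDomain S] (p : ℕ) [Fact p.Prime]
    [CharP S p] (x y : Fin 3 → S) (I : Ideal S) (hx : ∀ i, x i ^ p ∈ I) (hy : ∀ i, y i ^ p ∈ I) :
    ((x 1 * y 2 - x 2 * y 1) * (x 2 * y 0 - x 0 * y 2) * (x 0 * y 1 - x 1 * y 0)) ^ (p - 1)
      ∈ I := by
  have hp := (Fact.out : p.Prime).one_le
  rw [← Ideal.Quotient.eq_zero_iff_mem, mul_pow, mul_pow, sub_pow_prime_sub_one p,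
    sub_pow_prime_sub_one p, sub_pow_prime_sub_one p, Finset.sum_mul_sum, Finset.sum_mul_sum]
  simp only [Finset.sum_mul, map_sum, map_mul, map_pow]
  have hX : ∀ i n, p ≤ n → Ideal.Quotient.mk I (x i) ^ n = 0 := fun i n hn => by
    rw [← map_pow, Ideal.Quotient.eq_zero_iff_mem]
    exact I.mem_of_dvd (pow_dvd_pow _ hn) (hx i)
  have hY : ∀ i n, p ≤ n → Ideal.Quotient.mk I (y i) ^ n = 0 := fun i n hn => by
    rw [← map_pow, Ideal.Quotient.eq_zero_iff_mem]
    exact I.mem_of_dvd (pow_dvd_pow _ hn) (hy i)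
  generalize hX' : (fun i => Ideal.Quotient.mk I (x i)) = X at *
  generalize hY' : (fun i => Ideal.Quotient.mk I (y i)) = Y at *
  simp only [funext_iff] at hX' hY'
  simp only [hX', hY'] at *
  have hp0 : (p : S ⧸ I) = 0 := by
    rw [← map_natCast (Ideal.Quotient.mk I), CharP.cast_eq_zero, map_zero]
  have key : ∀ i ∈ Finset.range p, ∀ k ∈ Finset.range p, ∀ j ∈ Finset.range p,
      (X 1 * Y 2) ^ i * (X 2 * Y 1) ^ (p - 1 - i) * ((X 2 * Y 0) ^ j * (X 0 * Y 2) ^ (p - 1 - j))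
        * ((X 0 * Y 1) ^ k * (X 1 * Y 0) ^ (p - 1 - k))
      = if j = i then (if k = i then (X 0 * X 1 * X 2 * Y 0 * Y 1 * Y 2) ^ (p - 1) else 0)
        else 0 := by
    intro i hi k hk j hj
    rw [Finset.mem_range] at hi hk hj
    have e : (X 1 * Y 2) ^ i * (X 2 * Y 1) ^ (p - 1 - i) *
        ((X 2 * Y 0) ^ j * (X 0 * Y 2) ^ (p - 1 - j))
        * ((X 0 * Y 1) ^ k * (X 1 * Y 0) ^ (p - 1 - k))
        = X 0 ^ (p - 1 - j + k) * X 1 ^ (i + (p - 1 - k)) * X 2 ^ (p - 1 - i + j)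
          * Y 0 ^ (j + (p - 1 - k)) * Y 1 ^ (p - 1 - i + k) * Y 2 ^ (i + (p - 1 - j)) := by
      simp only [mul_pow, pow_add]; ring
    rw [e]
    split_ifs with h1 h2
    · subst h1 h2
      have a1 : p - 1 - k + k = p - 1 := by omega
      have a2 : k + (p - 1 - k) = p - 1 := by omega
      rw [a1, a2]; simp only [mul_pow]
    · rcases lt_or_gt_of_ne h2 with h | h
      · rw [hX 1 (i + (p - 1 - k)) (by omega)]; simp
      · rw [hY 1 (p - 1 - i + k) (by omega)]; simp
    · rcases lt_or_gt_of_ne h1 with h | h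
      · rw [hY 2 (i + (p - 1 - j)) (by omega)]; simp
      · rw [hX 2 (p - 1 - i + j) (by omega)]; simp
  rw [Finset.sum_congr rfl fun i hi => Finset.sum_congr rfl fun k hk =>
    Finset.sum_congr rfl fun j hj => key i hi k hk j hj]
  rw [Finset.sum_congr rfl fun i hi => Finset.sum_congr rfl fun k _ =>
    (Finset.sum_ite_eq' _ i _).trans (if_pos hi)]
  rw [Finset.sum_congr rfl fun i hi => (Finset.sum_ite_eq' _ i _).trans (if_pos hi)]
  rw [Finset.sum_const, Finset.card_range, nsmul_eq_mul, hp0, zero_mul]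

end Minors

/-! ### Divisibility by edge binomials -/

section Divisibility

variable {V : Type v} {K : Type u} [Field K]

open MvPolynomial

theorem edgeBinomial_swap (i j : V) : edgeBinomial K j i = -edgeBinomial K i j := by
  simp only [edgeBinomial]; ring

/-- Laplace expansion of a `3 × 3` determinant with the row of `x`'s repeated. It chains binomials
along a walk. -/
theorem X_mul_edgeBinomial (a b c : V) :
    X (Sum.inl b) * edgeBinomial K a c
      = X (Sum.inl a) * edgeBinomial K b c + X (Sum.inl c) * edgeBinomial K a b := by
  simp only [edgeBinomial]; ring

/-- The binomial is linear in `y_j`, with coprime coefficients `x_i` and `-x_j y_i`. -/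
theorem prime_edgeBinomial {i j : V} (hij : i ≠ j) : Prime (edgeBinomial K i j) := by
  classical
  rw [← UniqueFactorizationMonoid.irreducible_iff_prime]
  have h : edgeBinomial K i j
      = X (Sum.inl i) * X (Sum.inr j) + -(X (Sum.inl j) * X (Sum.inr i)) := by
    rw [edgeBinomial, sub_eq_add_neg]
  rw [h]
  refine irreducible_mul_X_add _ _ _ (X_ne_zero _) (by simp [vars_X]) ?_ ?_
  · rw [vars_neg]
    intro hmem
    have := vars_mul _ _ hmem
    simp [vars_X, hij.symm] at this
  · rw [(X_prime (R := K) (i := (Sum.inl i : V ⊕ V))).irreducible.isRelPrime_iff_not_dvd, dvd_neg]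
    intro hd
    rcases (X_prime (R := K) (i := Sum.inl i)).dvd_or_dvd hd with h | h
    · rw [X_dvd_X] at h
      simp [hij] at h
    · rw [X_dvd_X] at h
      simp at h

/-- The substitution `y_j ↦ x_j y_i / x_i`, with values in the field of fractions. -/
noncomputable def minorSubst (K : Type u) [Field K] (i j : V) [DecidableEq V] :
    MvPolynomial (V ⊕ V) K →ₐ[K] FractionRing (MvPolynomial (V ⊕ V) K) :=
  aeval fun s => if s = Sum.inr j then
      algebraMap _ _ (X (Sum.inl j) : MvPolynomial (V ⊕ V) K)
        * (algebraMap _ _ (X (Sum.inr i) : MvPolynomial (V ⊕ V) K)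
          / algebraMap _ _ (X (Sum.inl i) : MvPolynomial (V ⊕ V) K))
    else algebraMap _ _ (X s : MvPolynomial (V ⊕ V) K)

theorem algebraMap_X_ne_zero (s : V ⊕ V) :
    algebraMap (MvPolynomial (V ⊕ V) K) (FractionRing (MvPolynomial (V ⊕ V) K)) (X s) ≠ 0 := by
  rw [Ne, FaithfulSMul.algebraMap_eq_zero_iff]
  exact X_ne_zero s

theorem not_edgeBinomial_dvd {i j k l : V} (e : V ⊕ V → K)
    (h0 : e (Sum.inl i) * e (Sum.inr j) - e (Sum.inl j) * e (Sum.inr i) = 0)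
    (h1 : e (Sum.inl k) * e (Sum.inr l) - e (Sum.inl l) * e (Sum.inr k) ≠ 0) :
    ¬ edgeBinomial K i j ∣ edgeBinomial K k l := by
  rintro ⟨q, hq⟩
  have := congrArg (eval e) hq
  simp only [edgeBinomial, map_sub, map_mul, eval_X, h0, zero_mul] at this
  exact h1 this

variable [DecidableEq V]

theorem minorSubst_edgeBinomial {i j : V} (hij : i ≠ j) :
    minorSubst K i j (edgeBinomial K i j) = 0 := by
  have := algebraMap_X_ne_zero (K := K) (Sum.inl i : V ⊕ V)
  simp only [minorSubst, edgeBinomial, map_sub, map_mul, aeval_X, reduceCtorEq, if_false, if_true,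
    Sum.inr.injEq, hij]
  field_simp
  ring

/-- Pseudo-division by `x_i y_j - x_j y_i` with respect to the variable `y_j`. -/
theorem exists_pseudoremainder {i j : V} (hij : i ≠ j) (f : MvPolynomial (V ⊕ V) K) :
    ∃ (n : ℕ) (h : MvPolynomial (V ⊕ V) K),
      -- Being fixed by the substitution plays the role of not involving `y_j`.
      edgeBinomial K i j ∣ X (Sum.inl i) ^ n * f - h ∧ minorSubst K i j h = algebraMap _ _ h := by
  induction f using MvPolynomial.induction_on with
  | C a =>
    refine ⟨0, C a, by simp, ?_⟩
    rw [← algebraMap_eq, AlgHom.commutes, ← IsScalarTower.algebraMap_apply]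
  | add f g hf hg =>
    obtain ⟨n, a, ⟨a', ha⟩, ha1⟩ := hf
    obtain ⟨m, b, ⟨b', hb⟩, hb1⟩ := hg
    have hx : minorSubst K i j (X (Sum.inl i))
        = algebraMap (MvPolynomial (V ⊕ V) K) _ (X (Sum.inl i)) := by
      simp [minorSubst]
    refine ⟨n + m, X (Sum.inl i) ^ m * a + X (Sum.inl i) ^ n * b,
      ⟨X (Sum.inl i) ^ m * a' + X (Sum.inl i) ^ n * b', ?_⟩, ?_⟩
    · linear_combination X (Sum.inl i) ^ m * ha + X (Sum.inl i) ^ n * hb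
    · simp only [map_add, map_mul, map_pow, ha1, hb1, hx]
  | mul_X f s hf =>
    obtain ⟨n, a, ⟨a', ha⟩, ha1⟩ := hf
    by_cases hs : s = Sum.inr j
    · subst hs
      -- One more factor `x_i` turns `y_j` into `x_i y_j`, which is `x_j y_i` modulo the binomial.
      refine ⟨n + 1, a * (X (Sum.inl j) * X (Sum.inr i)),
        ⟨X (Sum.inl i) * X (Sum.inr j) * a' + a, ?_⟩, ?_⟩
      · rw [edgeBinomial] at ha ⊢
        linear_combination X (Sum.inl i) * X (Sum.inr j) * ha
      · rw [map_mul, map_mul, map_mul, map_mul, ha1]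
        simp [minorSubst, hij]
    · refine ⟨n, a * X s, ⟨a' * X s, ?_⟩, ?_⟩
      · linear_combination X s * ha
      · rw [map_mul, map_mul, ha1]
        simp [minorSubst, hs]

/-- The pseudoremainder is both killed and fixed by the substitution, hence zero. Primality then
removes the power of `x_i`, which the substitution does not kill. -/
theorem edgeBinomial_dvd_of_minorSubst_eq_zero {i j : V} (hij : i ≠ j)
    {f : MvPolynomial (V ⊕ V) K} (hf : minorSubst K i j f = 0) : edgeBinomial K i j ∣ f := by
  obtain ⟨n, h, ⟨q, hq⟩, hh⟩ := exists_pseudoremainder hij f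
  have h0 : h = 0 := by
    have := congrArg (minorSubst K i j) hq
    rw [map_sub, map_mul, map_mul, hf, minorSubst_edgeBinomial hij, hh, mul_zero, zero_mul,
      zero_sub, neg_eq_zero, FaithfulSMul.algebraMap_eq_zero_iff] at this
    exact this
  have hp := prime_edgeBinomial (K := K) hij
  have hd : edgeBinomial K i j ∣ X (Sum.inl i) ^ n * f := ⟨q, by rw [← hq, h0, sub_zero]⟩
  refine (hp.dvd_or_dvd hd).resolve_left fun hx => ?_
  obtain ⟨r, hr⟩ := hp.dvd_of_dvd_pow hx
  have := congrArg (minorSubst K i j) hr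
  rw [map_mul, minorSubst_edgeBinomial hij, zero_mul] at this
  exact algebraMap_X_ne_zero (K := K) (Sum.inl i : V ⊕ V) (by simp [minorSubst] at this)

/-- Three minors of a generic `2 × 3` matrix are pairwise coprime. -/
theorem edgeBinomial_mul_dvd {a b c : V} (hab : a ≠ b) (hbc : b ≠ c) (hca : c ≠ a)
    {f : MvPolynomial (V ⊕ V) K} (h1 : edgeBinomial K b c ∣ f) (h2 : edgeBinomial K c a ∣ f)
    (h3 : edgeBinomial K a b ∣ f) :
    edgeBinomial K b c * edgeBinomial K c a * edgeBinomial K a b ∣ f := by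
  have := hab.symm
  have := hbc.symm
  have := hca.symm
  -- Each test point is a 0/1 matrix in which the columns of the divisor agree and the third column
  -- is independent of them.
  have n2 : ¬ edgeBinomial K c a ∣ edgeBinomial K b c :=
    not_edgeBinomial_dvd (fun s => if s = Sum.inl b ∨ s = Sum.inr a ∨ s = Sum.inr c then 1 else 0)
      (by simp [*])
      (by simp [*])
  have n3 : ¬ edgeBinomial K a b ∣ edgeBinomial K b c :=
    not_edgeBinomial_dvd (fun s => if s = Sum.inl a ∨ s = Sum.inl b ∨ s = Sum.inr c then 1 else 0)
      (by simp [*])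
      (by simp [*])
  have n4 : ¬ edgeBinomial K a b ∣ edgeBinomial K c a :=
    not_edgeBinomial_dvd (fun s => if s = Sum.inl a ∨ s = Sum.inl b ∨ s = Sum.inr c then 1 else 0)
      (by simp [*])
      (by simp [*])
  obtain ⟨f, rfl⟩ := h1
  obtain ⟨f, rfl⟩ := ((prime_edgeBinomial hca).dvd_or_dvd h2).resolve_left n2
  obtain ⟨f, rfl⟩ := (((prime_edgeBinomial hab).dvd_or_dvd h3).resolve_left n3 |>
    (prime_edgeBinomial hab).dvd_or_dvd).resolve_left n4
  exact ⟨f, by ring⟩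

end Divisibility

/-! ### Degenerating away the neighborhood of a vertex -/

section Degeneration

variable {V : Type v} {K : Type u} [Field K]

open MvPolynomial

open Classical in
/-- Setting the variables at the vertices outside `U` to zero. -/
noncomputable def restrictTo (K : Type u) [Field K] (U : Set V) :
    MvPolynomial (V ⊕ V) K →ₐ[K] MvPolynomial (V ⊕ V) K :=
  aeval fun s => if s.elim id id ∈ U then X s else 0

theorem restrictTo_X {U : Set V} {s : V ⊕ V} (hs : s.elim id id ∈ U) :
    restrictTo K U (X s) = X s := by
  simp [restrictTo, hs]

theorem restrictTo_edgeBinomial {U : Set V} {i j : V} (hi : i ∈ U) (hj : j ∈ U) :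
    restrictTo K U (edgeBinomial K i j) = edgeBinomial K i j := by
  simp [edgeBinomial, restrictTo, hi, hj]

theorem restrictTo_eq_zero {G : SimpleGraph V} {U : Set V} (hU : ∀ i ∈ U, ∀ j ∈ U, ¬ G.Adj i j)
    {f : MvPolynomial (V ⊕ V) K} (hf : f ∈ binomialEdgeIdeal K G) : restrictTo K U f = 0 := by
  suffices h : binomialEdgeIdeal K G ≤ RingHom.ker (restrictTo K U) from h hf
  refine Ideal.span_le.2 ?_
  rintro f ⟨i, j, hij, rfl⟩
  have : i ∉ U ∨ j ∉ U := by
    by_contra! h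
    exact hU i h.1 j h.2 hij
  rcases this with h | h <;> simp [RingHom.mem_ker, restrictTo, edgeBinomial, h]

open Classical in
/-- The `x`-coordinates of the degeneration: variables at `N` are killed, those at `U` are kept,
all the others become equal to a new variable. -/
noncomputable def degenCoord (K : Type u) [Field K] (N U : Set V) (v : V) :
    Polynomial (FractionRing (MvPolynomial (V ⊕ V) K)) :=
  if v ∈ N then 0 else if v ∈ U then
    Polynomial.C (algebraMap _ _ (X (Sum.inl v) : MvPolynomial (V ⊕ V) K)) else Polynomial.X

theorem degenCoord_ne_zero {N U : Set V} {v : V} (hv : v ∉ N) : degenCoord K N U v ≠ 0 := by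
  rw [degenCoord, if_neg hv]
  split_ifs
  · rw [Ne, Polynomial.C_eq_zero]
    exact algebraMap_X_ne_zero _
  · exact Polynomial.X_ne_zero

variable [DecidableEq V]

/-- The degeneration attached to a vertex `a` with neighborhood `N`: away from `N` and `a`, the
vector `(x_v, y_v)` becomes proportional to `(x_b, y_b)`. -/
noncomputable def degen (K : Type u) [Field K] (N U : Set V) (a b : V) :
    MvPolynomial (V ⊕ V) K →ₐ[K] Polynomial (FractionRing (MvPolynomial (V ⊕ V) K)) :=
  aeval (Sum.elim (degenCoord K N U) fun v =>
    if v = a then Polynomial.C (algebraMap _ _ (X (Sum.inr a) : MvPolynomial (V ⊕ V) K))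
    else degenCoord K N U v * Polynomial.C (algebraMap _ _ (X (Sum.inr b) : MvPolynomial (V ⊕ V) K)
      / algebraMap _ _ (X (Sum.inl b) : MvPolynomial (V ⊕ V) K)))

/-- An edge either meets `N(a)`, where the vector is zero, or avoids both `N(a)` and `a`, where all
vectors are proportional. -/
theorem degen_eq_zero {G : SimpleGraph V} {U : Set V} (a b : V)
    {f : MvPolynomial (V ⊕ V) K} (hf : f ∈ binomialEdgeIdeal K G) :
    degen K (G.neighborSet a) U a b f = 0 := by
  suffices h : binomialEdgeIdeal K G ≤ RingHom.ker (degen K (G.neighborSet a) U a b) from h hf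
  refine Ideal.span_le.2 ?_
  have key : ∀ i j, G.Adj i j → i ∈ G.neighborSet a →
      degen K (G.neighborSet a) U a b (edgeBinomial K i j) = 0 := by
    intro i j hij hi
    have hia : i ≠ a := fun h => G.loopless.irrefl a (by simp [h] at hi)
    have h0 : degenCoord K (G.neighborSet a) U i = 0 := if_pos hi
    simp [degen, edgeBinomial, h0, hia]
  rintro f ⟨i, j, hij, rfl⟩
  rw [SetLike.mem_coe, RingHom.mem_ker]
  by_cases hi : i ∈ G.neighborSet a
  · exact key i j hij hi
  by_cases hj : j ∈ G.neighborSet a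
  · rw [edgeBinomial_swap, map_neg, neg_eq_zero]
    exact key j i hij.symm hj
  have hia : i ≠ a := by rintro rfl; exact hj hij
  have hja : j ≠ a := by rintro rfl; exact hi hij.symm
  simp only [degen, edgeBinomial, map_sub, map_mul, aeval_X, Sum.elim_inl, Sum.elim_inr, hia, hja,
    if_false]
  ring

/-- The new variable keeps the vertices off `N` nonzero while a cofactor is cancelled in a domain.
Setting it to zero afterwards removes all vertices outside the triple and leaves only the
proportionality of `b` and `c`. -/
theorem eval_zero_degen {N : Set V} {a b c : V} (hab : a ≠ b) (hbc : b ≠ c) (hca : c ≠ a)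
    (ha : a ∉ N) (hb : b ∉ N) (hc : c ∉ N) (f : MvPolynomial (V ⊕ V) K) :
    Polynomial.eval 0 (degen K N {a, b, c} a b f) = minorSubst K b c (restrictTo K {a, b, c} f) := by
  suffices h : ((Polynomial.evalRingHom (0 : FractionRing (MvPolynomial (V ⊕ V) K))).comp
      (degen K N {a, b, c} a b).toRingHom)
      = ((minorSubst K b c).comp (restrictTo K {a, b, c})).toRingHom from congrArg (· f) h
  have hx := algebraMap_X_ne_zero (K := K) (Sum.inl b : V ⊕ V)
  have := hab.symm
  have := hbc.symm
  have := hca.symm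
  refine MvPolynomial.ringHom_ext (fun r => ?_) fun s => ?_
  · simp [degen, ← algebraMap_eq, Polynomial.algebraMap_apply]
  · have out : ∀ v, v ∉ ({a, b, c} : Set V) → Polynomial.eval 0 (degenCoord K N {a, b, c} v) = 0 :=
      fun v hv => by rw [degenCoord, if_neg hv]; split_ifs <;> simp
    by_cases hs : s.elim id id ∈ ({a, b, c} : Set V)
    · rcases s with v | v <;> simp only [Sum.elim_inl, Sum.elim_inr, id] at hs <;>
        rcases hs with rfl | rfl | rfl <;>
        simp [degen, degenCoord, restrictTo, minorSubst, *]
      all_goals field_simp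
    · have hr : restrictTo K {a, b, c} (X s) = 0 := by simp only [restrictTo, aeval_X, if_neg hs]
      rcases s with v | v <;> simp only [Sum.elim_inl, Sum.elim_inr, id] at hs <;>
        have hva : v ≠ a := fun h => hs (Or.inl h) <;>
        simp [degen, hr, out v hs, hva]

/-- An element annihilated, modulo `J_G`, by a polynomial surviving in the degeneration at `a`
becomes divisible by `x_b y_c - x_c y_b` when restricted to `{a, b, c}`. -/
theorem edgeBinomial_dvd_restrictTo {G : SimpleGraph V} {a b c : V}
    (hab : a ≠ b) (hbc : b ≠ c) (hca : c ≠ a) (hb : ¬ G.Adj a b) (hc : ¬ G.Adj a c)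
    {g f : MvPolynomial (V ⊕ V) K}
    (hg : degen K (G.neighborSet a) {a, b, c} a b g ≠ 0) (hf : g * f ∈ binomialEdgeIdeal K G) :
    edgeBinomial K b c ∣ restrictTo K {a, b, c} f := by
  refine edgeBinomial_dvd_of_minorSubst_eq_zero hbc ?_
  rw [← eval_zero_degen (N := G.neighborSet a) hab hbc hca (G.loopless.irrefl a) hb hc]
  have h := degen_eq_zero (U := {a, b, c}) a b hf
  rw [map_mul] at h
  rw [(mul_eq_zero.1 h).resolve_left hg, Polynomial.eval_zero]

/-- If `b` and `c` are connected away from the neighborhood of `a`, then `x_b y_c - x_c y_b` is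
annihilated modulo `J_G` by a polynomial which survives in the degeneration at `a`. -/
theorem exists_mul_edgeBinomial_mem {G : SimpleGraph V} {U : Set V} (a d : V)
    {b c : ((G.neighborSet a)ᶜ : Set V)} (h : (G.induce (G.neighborSet a)ᶜ).Reachable b c) :
    ∃ g : MvPolynomial (V ⊕ V) K, degen K (G.neighborSet a) U a d g ≠ 0 ∧
      g * edgeBinomial K (b : V) (c : V) ∈ binomialEdgeIdeal K G := by
  obtain ⟨walk⟩ := h
  induction walk with
  | nil => exact ⟨1, by simp, by simp [edgeBinomial]⟩
  | @cons b e c hbe _ ih =>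
    obtain ⟨g, hg, hmem⟩ := ih
    -- Each step of the walk costs a factor `x_e`, nonzero in the degeneration because `e` is not in
    -- `N(a)`.
    refine ⟨g * X (Sum.inl (e : V)), ?_, ?_⟩
    · rw [map_mul]
      refine mul_ne_zero hg ?_
      have := degenCoord_ne_zero (K := K) (U := U) e.2
      simpa [degen] using this
    · have hbe' : edgeBinomial K (b : V) (e : V) ∈ binomialEdgeIdeal K G :=
        Ideal.subset_span ⟨b, e, by simpa using hbe, rfl⟩
      rw [mul_assoc, X_mul_edgeBinomial, mul_add, mul_left_comm, ← mul_assoc g (X _)]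
      exact Ideal.add_mem _ (Ideal.mul_mem_left _ _ hmem) (Ideal.mul_mem_left _ _ hbe')

end Degeneration

/-! ### Asteroidal triples -/

section Asteroidal

variable {V : Type v}

/-- Off its neighborhood, `a` is a component by itself, so only one component is left for all other
vertices. -/
theorem reachable_of_isMinimalVertexSeparator {G : SimpleGraph V} {a : V}
    (h : IsMinimalVertexSeparator G (G.neighborSet a)) {b c : V} (hab : a ≠ b) (hac : a ≠ c)
    (hb : b ∈ (G.neighborSet a)ᶜ) (hc : c ∈ (G.neighborSet a)ᶜ) :
    (G.induce (G.neighborSet a)ᶜ).Reachable ⟨b, hb⟩ ⟨c, hc⟩ := by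
  have ha : a ∈ (G.neighborSet a)ᶜ := G.loopless.irrefl a
  have isolated : ∀ d (hd : d ∈ (G.neighborSet a)ᶜ), a ≠ d →
      (G.induce (G.neighborSet a)ᶜ).connectedComponentMk ⟨d, hd⟩
        ≠ (G.induce (G.neighborSet a)ᶜ).connectedComponentMk ⟨a, ha⟩ := by
    intro d hd had heq
    obtain ⟨walk⟩ := (SimpleGraph.ConnectedComponent.exact heq).symm
    cases walk with
    | nil => exact had rfl
    | @cons _ e _ hae _ => exact e.2 (by simpa using hae)
  obtain ⟨y, -, huniq⟩ := (Nat.card_eq_two_iff'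
    ((G.induce (G.neighborSet a)ᶜ).connectedComponentMk ⟨a, ha⟩)).1 h.2
  exact SimpleGraph.ConnectedComponent.exact
    ((huniq _ (isolated b hb hab)).trans (huniq _ (isolated c hc hac)).symm)

open MvPolynomial in
/-- A graph having three pairwise nonadjacent vertices, any two of which are connected away from
the neighborhood of the third, has a binomial edge ring that is not F-pure. -/
theorem not_isFPure_of_asteroidal (G : SimpleGraph V) (w : Fin 3 → V) (hw : Function.Injective w)
    (hnonadj : ∀ i j : Fin 3, ¬ G.Adj (w i) (w j))
    (hreach : ∀ k : Fin 3, (G.induce (G.neighborSet (w k))ᶜ).Reachable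
      ⟨w (k + 1), hnonadj k (k + 1)⟩ ⟨w (k + 2), hnonadj k (k + 2)⟩)
    (p : ℕ) [Fact p.Prime] (K : Type u) [Field K] [CharP K p] :
    ¬ IsFPure (BinomialEdgeRing K G) p := by
  classical
  intro hR
  have h01 : w 0 ≠ w 1 := hw.ne (by decide)
  have h12 : w 1 ≠ w 2 := hw.ne (by decide)
  have h20 : w 2 ≠ w 0 := hw.ne (by decide)
  let U (k : Fin 3) : Set V := {w k, w (k + 1), w (k + 2)}
  -- The three degenerations list the triple in different cyclic orders, but restrict to the same
  -- set.
  have hU : ∀ k, U k = Set.range w := fun k => by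
    ext v
    fin_cases k <;> simp [U, Fin.exists_fin_succ, eq_comm] <;> tauto
  choose g hg hgmem using fun k : Fin 3 =>
    exists_mul_edgeBinomial_mem (K := K) (U := U k) (w k) (w (k + 1)) (hreach k)
  let D := edgeBinomial K (w 1) (w 2) * edgeBinomial K (w 2) (w 0) * edgeBinomial K (w 0) (w 1)
  have hgD : ∀ k, g k * D ∈ binomialEdgeIdeal K G := fun k => by
    refine Ideal.mem_of_dvd _ (mul_dvd_mul_left (g k) ?_) (hgmem k)
    fin_cases k
    · exact (dvd_mul_right _ _).mul_right _
    · exact (dvd_mul_left _ _).mul_right _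
    · exact dvd_mul_left _ _
  have hD0 : D ≠ 0 := mul_ne_zero (mul_ne_zero (prime_edgeBinomial h12).ne_zero
    (prime_edgeBinomial h20).ne_zero) (prime_edgeBinomial h01).ne_zero
  let x : Fin 3 ⊕ Fin 3 → MvPolynomial (V ⊕ V) K := fun s => X (Sum.map w w s)
  have hmem : D ^ (p - 1) ∈ Ideal.span (Set.range fun s => x s ^ p) :=
    minors_pow_mem p (fun i => x (Sum.inl i)) (fun i => x (Sum.inr i)) _
      (fun i => Ideal.subset_span ⟨Sum.inl i, rfl⟩) (fun i => Ideal.subset_span ⟨Sum.inr i, rfl⟩)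
  obtain ⟨s, hs⟩ := Ideal.mem_span_range_iff_exists_fun.1 hmem
  let π := Ideal.Quotient.mk (binomialEdgeIdeal K G)
  have hp : p ≠ 0 := (Fact.out : p.Prime).ne_zero
  -- The Frobenius power of the system is solved by `D * s i`: `D ^ p = ∑ x_i ^ p * (D * s i)`, and
  -- `g k * D ∈ J_G`.
  obtain ⟨t, ht, htg⟩ := hR.exists_solution (fun i => π (x i)) (fun k => π (g k)) (π D)
    (fun i => π (D * s i))
    (by
      rw [← map_pow, ← pow_sub_one_mul hp, ← hs, Finset.sum_mul, map_sum]
      refine Finset.sum_congr rfl fun i _ => ?_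
      rw [← map_pow, ← map_mul]
      congr 1
      ring)
    (fun i k => by
      rw [← map_pow, ← map_mul, Ideal.Quotient.eq_zero_iff_mem, ← mul_assoc,
        ← pow_sub_one_mul hp, mul_assoc (g k ^ (p - 1))]
      exact Ideal.mul_mem_right _ _ (Ideal.mul_mem_left _ _ (hgD k)))
  choose z hz using fun i => Ideal.Quotient.mk_surjective (t i)
  have hdvd : ∀ i, D ∣ restrictTo K (Set.range w) (z i) := fun i => by
    have key : ∀ k : Fin 3, edgeBinomial K (w (k + 1)) (w (k + 2))
        ∣ restrictTo K (Set.range w) (z i) := fun k => by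
      rw [← hU k]
      refine edgeBinomial_dvd_restrictTo (G := G) (hw.ne ?_) (hw.ne ?_) (hw.ne ?_)
        (hnonadj _ _) (hnonadj _ _) (hg k) ?_
      · revert k; decide
      · revert k; decide
      · revert k; decide
      · rw [← Ideal.Quotient.eq_zero_iff_mem, map_mul, hz]
        exact htg i k
    exact edgeBinomial_mul_dvd h01 h12 h20 (key 0) (key 1) (key 2)
  choose q hq using hdvd
  have hsum : D - ∑ i, x i * z i ∈ binomialEdgeIdeal K G := by
    rw [← Ideal.Quotient.eq_zero_iff_mem, map_sub, sub_eq_zero, map_sum]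
    simp only [map_mul, hz]
    exact ht.symm
  have hres := restrictTo_eq_zero (U := Set.range w)
    (by rintro _ ⟨i, rfl⟩ _ ⟨j, rfl⟩; exact hnonadj i j) hsum
  have hresD : restrictTo K (Set.range w) D = D := by
    simp only [D, map_mul]
    rw [restrictTo_edgeBinomial, restrictTo_edgeBinomial, restrictTo_edgeBinomial] <;>
      exact Set.mem_range_self _
  have hresx : ∀ i, restrictTo K (Set.range w) (x i) = x i := fun i =>
    restrictTo_X (by rcases i with i | i <;> exact Set.mem_range_self _)
  have hone : D * (1 - ∑ i, x i * q i) = 0 := by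
    have hterm : ∀ i, restrictTo K (Set.range w) (x i * z i) = D * (x i * q i) := fun i => by
      rw [map_mul, hresx, hq, mul_left_comm]
    rw [map_sub, hresD, map_sum, Finset.sum_congr rfl fun i _ => hterm i, ← Finset.mul_sum] at hres
    rw [mul_sub, mul_one, hres]
  -- The `x i` have no constant term, so comparing constant terms gives `1 = 0`.
  have := congrArg constantCoeff ((mul_eq_zero.1 hone).resolve_left hD0)
  simp [x] at this

end Asteroidal

theorem theorem4 {V : Type v} [Finite V] (G : SimpleGraph V) (hG : G.Connected)
    (w : Fin 3 → V) (hw : Function.Injective w)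
    (hnonadj : ∀ i j : Fin 3, ¬ G.Adj (w i) (w j))
    (hisol : ∀ i : Fin 3, IsMinimalVertexIsolator G (G.neighborSet (w i)))
    (hdecomp : ∀ i : Fin 3,
      deleteSet G (G.neighborSet (w i))
          = G.singletonSubgraph (w i) ⊔ deleteSet G (closedNbhd G (w i)) ∧
        Disjoint (G.singletonSubgraph (w i)) (deleteSet G (closedNbhd G (w i))))
    (p : ℕ) [Fact p.Prime] (K : Type u) [Field K] [CharP K p] :
    ¬ IsFPure (BinomialEdgeRing K G) p :=
  not_isFPure_of_asteroidal G w hw hnonadj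
    (fun k => reachable_of_isMinimalVertexSeparator (hisol k).1
      (hw.ne (by revert k; decide)) (hw.ne (by revert k; decide)) _ _) p K
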